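/- For $n\in\mathbb{N}$ regard $\mathbb{Z}^n$ as the graph in which $x$ and $y$ are adjacent exactly when $y=x\pm e_i$ for some $i\in[n]=\{1,\dots,n\}$, where $e_1,\dots,e_n$ is the standard basis, and let $\Gamma(x)$ denote the set of the $2n$ neighbours of $x$. A set $X\subseteq\mathbb{Z}^n$ is $p$-biased if $|\Gamma(x)\cap X|=2pn$ for all $x\in\mathbb{Z}^n$. A biased partition of $\mathbb{Z}^n$ is a partition $\{X_i\}_{i\in[2n]}$ of $\mathbb{Z}^n$ into $2n$ sets, each of which is $\frac{1}{2n}$-biased. Two biased partitions $\{X_i\}_{i\in[2n]}$ and $\{Y_i\}_{i\in[2n]}$ of $\mathbb{Z}^n$ are isomorphic if there exist a graph automorphism $\phi$ of $\mathbb{Z}^n$ and a permutation $\sigma$ of $[2n]$ such that $\phi(X_i)=Y_{\sigma(i)}$ for all $i\in[2n]$. **Theorem.** For every integer $n>1$ there are exactly $2^{\aleph_0}$ non-isomorphic biased partitions of $\mathbb{Z}^n$; that is, the set of isomorphism classes of biased partitions of $\mathbb{Z}^n$ has cardinality $2^{\aleph_0}$. -/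

import Mathlib

/-- The integer lattice `ℤ^n` as a graph: its edges are the pairs `{x, x + e_i}`. -/
def latticeGraph (n : ℕ) : SimpleGraph (Fin n → ℤ) where
  Adj x y := ∃ i : Fin n, y = x + Pi.single i 1 ∨ x = y + Pi.single i 1
  symm := ⟨fun _ _ ⟨i, h⟩ => ⟨i, h.symm⟩⟩
  loopless := ⟨by
    rintro x ⟨i, h | h⟩ <;> simpa using congrFun h i⟩

/-- A set `X ⊆ ℤ^n` is `p`-biased if every vertex `x` of `ℤ^n` has exactly `2pn`
of its `2n` neighbours in `X`. -/
def IsBiasedSet (n : ℕ) (p : ℝ) (X : Set (Fin n → ℤ)) : Prop :=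
  ∀ x : Fin n → ℤ, (((latticeGraph n).neighborSet x ∩ X).ncard : ℝ) = 2 * p * n

/-- A biased partition of `ℤ^n`: a partition of `ℤ^n` into `2n` sets, indexed by
`2n` labels, each of which is `1/(2n)`-biased. -/
structure BiasedPartition (n : ℕ) where
  part : Fin (2 * n) → Set (Fin n → ℤ)
  disjoint : Pairwise fun i j => Disjoint (part i) (part j)
  cover : ⋃ i, part i = Set.univ
  biased : ∀ i, IsBiasedSet n (1 / (2 * n)) (part i)

/-- Two biased partitions are isomorphic if some graph automorphism of `ℤ^n` carries
the parts of the first to the parts of the second, up to a permutation of the labels. -/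
def BiasedPartition.Isomorphic {n : ℕ} (X Y : BiasedPartition n) : Prop :=
  ∃ (φ : latticeGraph n ≃g latticeGraph n) (σ : Equiv.Perm (Fin (2 * n))),
    ∀ i, φ '' X.part i = Y.part (σ i)

theorem BiasedPartition.isomorphic_equivalence (n : ℕ) :
    Equivalence (BiasedPartition.Isomorphic (n := n)) where
  refl X := ⟨SimpleGraph.Iso.refl, Equiv.refl _, fun i => by simp [SimpleGraph.Iso.refl]⟩
  symm := by
    rintro X Y ⟨φ, σ, h⟩
    refine ⟨φ.symm, σ.symm, fun i => ?_⟩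
    have h1 := h (σ.symm i)
    rw [Equiv.apply_symm_apply] at h1
    rw [← h1, Set.image_image]
    simp
  trans := by
    rintro X Y Z ⟨φ, σ, h⟩ ⟨ψ, τ, k⟩
    refine ⟨φ.trans ψ, σ.trans τ, fun i => ?_⟩
    rw [Equiv.trans_apply, ← k, ← h, Set.image_image]
    rfl

/-- Isomorphism as an equivalence relation; the classes of its quotient are the
isomorphism classes of biased partitions of `ℤ^n`. -/
def BiasedPartition.isoSetoid (n : ℕ) : Setoid (BiasedPartition n) :=
  ⟨BiasedPartition.Isomorphic, BiasedPartition.isomorphic_equivalence n⟩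

/-!
The linear form `∑ (2i + 1) xᵢ` takes the values `±1, ±3, …, ±(2n - 1)` on the `2n` directions, that
is, each odd residue modulo `4n` exactly once, so its residues, paired up, colour `ℤⁿ` in such a way
that every vertex sees every colour exactly once. Adding `2n` to the form swaps the residues of `eᵢ`
and `-eⱼ`, where `i` and `j` are mirror images of each other. These two directions change the
difference of the first and the last coordinate equally, so on each level set of that difference
the shift by `2n` can be switched on or off independently. This gives `2^ℵ₀` biased partitions. An
automorphism of `ℤⁿ` is determined by its values on a single closed neighbourhood, so there are only
countably many of them, and each isomorphism class is countable.
-/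

open Cardinal

theorem mk_quotient_eq_of_countable_classes {α : Type*} (s : Setoid α)
    (hs : ∀ x, {y | s x y}.Countable) (hα : ℵ₀ < #α) : #(Quotient s) = #α := by
  refine mk_quotient_le.antisymm (not_lt.1 fun hlt => ?_)
  have hfib : ∀ q, #(Quotient.mk s ⁻¹' {q}) ≤ ℵ₀ := by
    rintro ⟨x⟩
    exact le_aleph0_iff_set_countable.2 <| (hs x).mono fun y hy => s.symm (Quotient.exact hy)
  exact (mk_le_mk_mul_of_mk_preimage_le _ hfib).not_gt (mul_lt_of_lt hα.le hlt hα)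

/-- The `2n` directions `±eᵢ` of the lattice `ℤⁿ`: the pair `(i, s)` stands for `s eᵢ`. -/
abbrev Direction (n : ℕ) := Fin n × ℤˣ

namespace Direction

variable {n : ℕ}

/-- The signed standard basis vector `s eᵢ` in the direction `(i, s)`. -/
def vec (u : Direction n) : Fin n → ℤ := Pi.single u.1 (u.2 : ℤ)

theorem vec_neg (i : Fin n) (s : ℤˣ) : vec (i, -s) = -vec (i, s) := by
  simp [vec, Pi.single_neg]

theorem vec_dotProduct_vec (u v : Direction n) :
    u.vec ⬝ᵥ v.vec = if u.1 = v.1 then (u.2 * v.2 : ℤ) else 0 := by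
  simp [vec, Pi.single_apply, eq_comm]

theorem vec_dotProduct_self (u : Direction n) : u.vec ⬝ᵥ u.vec = 1 := by
  rw [vec_dotProduct_vec, if_pos rfl]
  exact Int.units_coe_mul_self u.2

theorem vec_dotProduct_nonpos {u v : Direction n} (h : u ≠ v) : u.vec ⬝ᵥ v.vec ≤ 0 := by
  obtain ⟨i, s⟩ := u
  obtain ⟨j, t⟩ := v
  rw [vec_dotProduct_vec]
  split_ifs with hij
  · obtain rfl : i = j := hij
    rcases Int.units_eq_one_or s with rfl | rfl <;>
      rcases Int.units_eq_one_or t with rfl | rfl <;> simp at h ⊢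
  · rfl

theorem vec_dotProduct_nonneg {u v : Direction n} (h : u.vec + v.vec ≠ 0) :
    0 ≤ u.vec ⬝ᵥ v.vec := by
  have hne : u ≠ (v.1, -v.2) := by
    rintro rfl
    exact h (by rw [vec_neg, neg_add_cancel])
  simpa [vec_neg] using vec_dotProduct_nonpos hne

theorem vec_injective : Function.Injective (vec : Direction n → Fin n → ℤ) := by
  intro u v h
  by_contra huv
  have hself := vec_dotProduct_self u
  have hnonpos := vec_dotProduct_nonpos huv
  rw [← h] at hnonpos
  omega

theorem eq_of_vec_add_vec_eq {u v a b : Direction n} (huv : u ≠ v)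
    (h : u.vec + a.vec = v.vec + b.vec) (h0 : u.vec + a.vec ≠ 0) : a = v := by
  have hdot : 1 + u.vec ⬝ᵥ a.vec = u.vec ⬝ᵥ v.vec + u.vec ⬝ᵥ b.vec := by
    rw [← vec_dotProduct_self u, ← dotProduct_add, ← dotProduct_add, h]
  obtain rfl : u = b := by
    by_contra hub
    linarith [vec_dotProduct_nonneg h0, vec_dotProduct_nonpos huv, vec_dotProduct_nonpos hub]
  rw [add_comm] at h
  exact vec_injective (add_right_cancel h)

theorem closure_range_vec :
    AddSubmonoid.closure (Set.range (vec : Direction n → Fin n → ℤ)) = ⊤ := by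
  refine eq_top_iff.2 fun x _ => ?_
  rw [← Finset.univ_sum_single x]
  refine sum_mem fun i _ => ?_
  obtain ⟨m, s, hm⟩ : ∃ (m : ℕ) (s : ℤˣ), x i = m * s := by
    obtain ⟨m, hm | hm⟩ := Int.eq_nat_or_neg (x i)
    · exact ⟨m, 1, by simp [hm]⟩
    · exact ⟨m, -1, by simp [hm]⟩
  have hvec : Pi.single i (x i) = m • vec (i, s) := by
    rw [hm, vec, ← Pi.single_smul, nsmul_eq_mul]
  rw [hvec]
  exact nsmul_mem (AddSubmonoid.subset_closure (Set.mem_range_self _)) m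

end Direction

section Automorphisms

variable {n : ℕ}

theorem latticeGraph_adj_iff {x y : Fin n → ℤ} :
    (latticeGraph n).Adj x y ↔ ∃ u : Direction n, y = x + u.vec := by
  constructor
  · rintro ⟨i, h | h⟩
    · exact ⟨(i, 1), h⟩
    · exact ⟨(i, -1), by rw [h, Direction.vec_neg]; exact (add_neg_cancel_right _ _).symm⟩
  · rintro ⟨⟨i, s⟩, rfl⟩
    rcases Int.units_eq_one_or s with rfl | rfl
    · exact ⟨i, Or.inl rfl⟩
    · exact ⟨i, Or.inr (by rw [Direction.vec_neg]; exact (neg_add_cancel_right _ _).symm)⟩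

theorem latticeGraph_adj_add_vec (x : Fin n → ℤ) (u : Direction n) :
    (latticeGraph n).Adj x (x + u.vec) :=
  latticeGraph_adj_iff.2 ⟨u, rfl⟩

theorem lattice_induction {P : (Fin n → ℤ) → Prop} (zero : P 0)
    (add_vec : ∀ x (u : Direction n), P x → P (x + u.vec)) (x : Fin n → ℤ) : P x := by
  have hx : x ∈ AddSubmonoid.closure (Set.range (Direction.vec : Direction n → _)) :=
    Direction.closure_range_vec ▸ AddSubmonoid.mem_top x
  induction hx using AddSubmonoid.closure_induction_right with
  | zero => exact zero
  | add_right y _ v hv ih =>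
    obtain ⟨u, rfl⟩ := hv
    exact add_vec y u ih

/-- The map `ψ` fixes the closed unit ball of the graph `ℤⁿ` about `x` pointwise. For an
automorphism this property spreads from `x` to its neighbours, and hence everywhere. -/
def FixesBall (ψ : (Fin n → ℤ) → (Fin n → ℤ)) (x : Fin n → ℤ) : Prop :=
  ψ x = x ∧ ∀ u : Direction n, ψ (x + u.vec) = x + u.vec

variable {ψ : SimpleGraph.Copy (latticeGraph n) (latticeGraph n)}

theorem exists_apply_add_vec_eq {x : Fin n → ℤ} (hx : ψ x = x) (u : Direction n) :
    ∃ a : Direction n, ψ (x + u.vec) = x + a.vec := by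
  have hadj : (latticeGraph n).Adj (ψ x) (ψ (x + u.vec)) :=
    ψ.toHom.map_adj (latticeGraph_adj_add_vec x u)
  rw [hx] at hadj
  exact latticeGraph_adj_iff.1 hadj

namespace FixesBall

variable {x : Fin n → ℤ}

/-- The only common neighbours of `x + u` and `x + v` are `x` and `x + u + v`, and `x` is taken. -/
theorem apply_add_vec_add_vec_of_ne (h : FixesBall ψ x) {u v : Direction n} (huv : u ≠ v) :
    ψ (x + u.vec + v.vec) = x + u.vec + v.vec := by
  obtain ⟨a, ha⟩ := exists_apply_add_vec_eq (h.2 u) v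
  obtain ⟨b, hb⟩ := exists_apply_add_vec_eq (h.2 v) u
  rw [add_right_comm x] at hb
  have hab : u.vec + a.vec = v.vec + b.vec :=
    add_left_cancel (a := x) (by rw [← add_assoc, ← add_assoc, ← ha, hb])
  by_cases h0 : u.vec + a.vec = 0
  · have hback : ψ (x + u.vec + v.vec) = x := by rw [ha, add_assoc, h0, add_zero]
    rw [hback]
    exact (ψ.injective (hback.trans h.1.symm)).symm
  · rw [ha, Direction.eq_of_vec_add_vec_eq huv hab h0]

theorem add_vec (h : FixesBall ψ x) (u : Direction n) : FixesBall ψ (x + u.vec) := by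
  refine ⟨h.2 u, fun v => ?_⟩
  obtain rfl | huv := eq_or_ne u v
  · obtain ⟨a, ha⟩ := exists_apply_add_vec_eq (h.2 u) u
    obtain rfl | hua := eq_or_ne u a
    · exact ha
    · have hinj := ψ.injective (ha.trans (h.apply_add_vec_add_vec_of_ne hua).symm)
      exact absurd (Direction.vec_injective (add_left_cancel hinj)) hua
  · exact h.apply_add_vec_add_vec_of_ne huv

theorem apply_eq_self (h : FixesBall ψ 0) (x : Fin n → ℤ) : ψ x = x :=
  (lattice_induction (P := FixesBall ψ) h (fun _ u hy => hy.add_vec u) x).1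

end FixesBall

theorem countable_latticeGraph_iso (n : ℕ) : Countable (latticeGraph n ≃g latticeGraph n) := by
  let jet (φ : latticeGraph n ≃g latticeGraph n) : (Fin n → ℤ) × (Direction n → Fin n → ℤ) :=
    (φ 0, fun u => φ u.vec)
  refine Function.Injective.countable (f := jet) fun φ ψ h => ?_
  have h0 : φ 0 = ψ 0 := congrArg Prod.fst h
  have hvec (u : Direction n) : φ u.vec = ψ u.vec := congrFun (congrArg Prod.snd h) u
  have hfix : FixesBall (SimpleGraph.Iso.toCopy (φ.trans ψ.symm)) 0 :=
    ⟨ψ.symm_apply_eq.2 h0, fun u => by rw [zero_add]; exact ψ.symm_apply_eq.2 (hvec u)⟩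
  exact RelIso.ext fun x => ψ.symm_apply_eq.1 (hfix.apply_eq_self x)

end Automorphisms

namespace BiasedPartition

variable {n : ℕ}

theorem part_injective : Function.Injective (part : BiasedPartition n → _) := by
  rintro ⟨_, _, _, _⟩ ⟨_, _, _, _⟩ rfl
  rfl

theorem countable_setOf_isomorphic (X : BiasedPartition n) :
    {Y : BiasedPartition n | X.Isomorphic Y}.Countable := by
  have := countable_latticeGraph_iso n
  let transport (p : (latticeGraph n ≃g latticeGraph n) × Equiv.Perm (Fin (2 * n)))
    (i : Fin (2 * n)) : Set (Fin n → ℤ) := p.1 '' X.part (p.2.symm i)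
  refine ((Set.countable_range transport).preimage part_injective).mono ?_
  rintro Y ⟨φ, σ, h⟩
  exact ⟨(φ, σ), funext fun i => by simp only [transport, h, σ.apply_symm_apply]⟩

theorem mk_le_two_power_aleph0 (n : ℕ) : #(BiasedPartition n) ≤ 2 ^ ℵ₀ := by
  calc #(BiasedPartition n) ≤ #(Fin (2 * n) → Set (Fin n → ℤ)) := mk_le_of_injective part_injective
    _ = #(Set (Fin n → ℤ)) ^ (2 * n) := by rw [← power_def, mk_fin, power_natCast]
    _ ≤ (2 ^ ℵ₀) ^ (2 * n) := by
      rw [mk_set]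
      gcongr
      exact power_le_power_left two_ne_zero mk_le_aleph0
    _ ≤ 2 ^ ℵ₀ := power_nat_le (cantor _).le

/-- The partition of `ℤⁿ` into the colour classes of a colouring for which every vertex has exactly
one neighbour of each colour. -/
def ofColoring (c : (Fin n → ℤ) → Fin (2 * n))
    (hc : ∀ x, Function.Bijective fun u : Direction n => c (x + u.vec)) : BiasedPartition n where
  part i := c ⁻¹' {i}
  disjoint _ _ hij := Disjoint.preimage c (Set.disjoint_singleton.2 hij)
  cover := by rw [← Set.preimage_iUnion, Set.iUnion_of_singleton, Set.preimage_univ]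
  biased i x := by
    have hn : (n : ℝ) ≠ 0 := by
      have := (c x).pos
      exact_mod_cast (by omega : n ≠ 0)
    obtain ⟨u, hu, huniq⟩ := (hc x).existsUnique i
    have hnbr : (latticeGraph n).neighborSet x ∩ c ⁻¹' {i} = {x + u.vec} := by
      refine Set.eq_singleton_iff_unique_mem.2 ⟨⟨latticeGraph_adj_add_vec x u, hu⟩, ?_⟩
      rintro y ⟨hy, hyi⟩
      obtain ⟨v, rfl⟩ := latticeGraph_adj_iff.1 hy
      rw [huniq v hyi]
    rw [hnbr, Set.ncard_singleton]
    field_simp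
    norm_num

theorem ofColoring_inj {c d : (Fin n → ℤ) → Fin (2 * n)}
    {hc : ∀ x, Function.Bijective fun u : Direction n => c (x + u.vec)}
    {hd : ∀ x, Function.Bijective fun u : Direction n => d (x + u.vec)}
    (h : ofColoring c hc = ofColoring d hd) : c = d := by
  funext x
  have hpart : c ⁻¹' {c x} = d ⁻¹' {c x} := congrFun (congrArg part h) (c x)
  have hx : x ∈ d ⁻¹' {c x} := hpart ▸ rfl
  exact hx.symm

end BiasedPartition

section TwistedColoring

theorem modEq_of_intCast_ediv_two_eq {m : ℕ} {a b : ℤ} (hab : a ≡ b [ZMOD 2])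
    (h : ((a / 2 : ℤ) : ZMod m) = (b / 2 : ℤ)) : a ≡ b [ZMOD 2 * m] := by
  have hhalf : 2 * (a / 2) ≡ 2 * (b / 2) [ZMOD 2 * m] :=
    ((ZMod.intCast_eq_intCast_iff _ _ m).1 h).mul_left'
  rw [← Int.mul_ediv_add_emod a 2, ← Int.mul_ediv_add_emod b 2, hab.eq]
  exact hhalf.add_right _

variable {n : ℕ}

/-- The linear form `∑ (2i + 1) xᵢ` on `ℤⁿ`, with the indices `i` starting from `0`. -/
def oddForm (x : Fin n → ℤ) : ℤ := (fun i : Fin n => (2 * i + 1 : ℤ)) ⬝ᵥ x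

theorem oddForm_add (x y : Fin n → ℤ) : oddForm (x + y) = oddForm x + oddForm y :=
  dotProduct_add _ _ _

theorem oddForm_vec (u : Direction n) : oddForm u.vec = (2 * u.1 + 1) * u.2 :=
  dotProduct_single _ _ _

theorem abs_oddForm_vec (u : Direction n) : |oddForm u.vec| = 2 * u.1 + 1 := by
  have hu : |(u.2 : ℤ)| = 1 := Int.isUnit_iff_abs_eq.1 u.2.isUnit
  rw [oddForm_vec, abs_mul, hu, mul_one]
  exact abs_of_nonneg (by positivity)

theorem odd_oddForm_vec (u : Direction n) : Odd (oddForm u.vec) := by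
  rw [← odd_abs, abs_oddForm_vec]
  exact odd_two_mul_add_one _

theorem oddForm_vec_injective : Function.Injective fun u : Direction n => oddForm u.vec := by
  rintro ⟨i, s⟩ ⟨j, t⟩ (h : oddForm _ = oddForm _)
  have habs := congrArg abs h
  rw [abs_oddForm_vec, abs_oddForm_vec] at habs
  obtain rfl : i = j := Fin.ext (by simpa using habs)
  rw [oddForm_vec, oddForm_vec] at h
  exact Prod.ext rfl (Units.ext (mul_left_cancel₀ (by positivity) h))

theorem eq_of_oddForm_vec_modEq {u v : Direction n}
    (h : oddForm u.vec ≡ oddForm v.vec [ZMOD 2 * (2 * n)]) : u = v := by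
  have hlt : |oddForm v.vec - oddForm u.vec| < 2 * (2 * n) := by
    refine (abs_sub _ _).trans_lt ?_
    rw [abs_oddForm_vec, abs_oddForm_vec]
    omega
  exact oddForm_vec_injective (sub_eq_zero.1 (Int.eq_zero_of_abs_lt_dvd h.dvd hlt)).symm

/-- The direction `-s e_{n - 1 - i}` mirror to `s eᵢ`; the form `oddForm` takes values on the two
that differ by `2n` modulo `4n`. -/
def Direction.mirror (u : Direction n) : Direction n := (u.1.rev, -u.2)

theorem Direction.mirror_injective : Function.Injective (mirror : Direction n → Direction n) :=
  Fin.rev_injective.prodMap neg_injective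

theorem oddForm_vec_mirror_modEq (u : Direction n) :
    oddForm u.mirror.vec ≡ oddForm u.vec + 2 * n [ZMOD 2 * (2 * n)] := by
  obtain ⟨i, s⟩ := u
  have hrev : ((i.rev : ℕ) : ℤ) = n - 1 - i := by
    rw [Fin.val_rev]
    omega
  refine Int.modEq_iff_dvd.2 ?_
  simp only [oddForm_vec, Direction.mirror, hrev]
  rcases Int.units_eq_one_or s with rfl | rfl
  · exact ⟨1, by push_cast; ring⟩
  · exact ⟨0, by push_cast; ring⟩

/-- The direction `u`, or its mirror image if the switch `b` is on. -/
def Direction.twist (b : Bool) (u : Direction n) : Direction n := if b then u.mirror else u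

theorem Direction.twist_injective (b : Bool) :
    Function.Injective (twist b : Direction n → Direction n) := by
  cases b
  · exact Function.injective_id
  · exact mirror_injective

theorem oddForm_vec_twist_modEq (b : Bool) (u : Direction n) :
    oddForm (u.twist b).vec ≡
      oddForm u.vec + (if b then (2 * n : ℤ) else 0) [ZMOD 2 * (2 * n)] := by
  cases b
  · simp [Direction.twist]
  · exact oddForm_vec_mirror_modEq u

variable [NeZero n]

/-- The difference of the first and the last coordinate. -/
def endDiff (x : Fin n → ℤ) : ℤ := x 0 - x (Fin.rev 0)

theorem endDiff_add (x y : Fin n → ℤ) : endDiff (x + y) = endDiff x + endDiff y :=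
  add_sub_add_comm _ _ _ _

theorem endDiff_vec_mirror (u : Direction n) : endDiff u.mirror.vec = endDiff u.vec := by
  have h0 : (0 : Fin n) = u.1.rev ↔ Fin.rev 0 = u.1 := by rw [← Fin.rev_eq_iff]
  simp only [endDiff, Direction.vec, Direction.mirror, Pi.single_apply, h0, Fin.rev_inj,
    Units.val_neg]
  split_ifs <;> ring

theorem endDiff_vec_twist (b : Bool) (u : Direction n) :
    endDiff (u.twist b).vec = endDiff u.vec := by
  cases b
  · rfl
  · exact endDiff_vec_mirror u

theorem endDiff_single_zero (hn : 1 < n) (k : ℤ) : endDiff (Pi.single (0 : Fin n) k) = k := by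
  have hrev : (Fin.rev 0 : Fin n) ≠ 0 := by
    rw [Fin.ne_iff_vne, Fin.val_rev, Fin.val_zero]
    omega
  simp [endDiff, hrev]

/-- The form `oddForm`, shifted by `2n` on those level sets of `endDiff` which `ε` selects. -/
def twistedForm (ε : ℤ → Bool) (x : Fin n → ℤ) : ℤ :=
  oddForm x + if ε (endDiff x) then (2 * n : ℤ) else 0

theorem twistedForm_modEq_two (ε : ℤ → Bool) (x : Fin n → ℤ) :
    twistedForm ε x ≡ oddForm x [ZMOD 2] := by
  unfold twistedForm Int.ModEq
  split_ifs <;> omega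

theorem twistedForm_add_vec_modEq (ε : ℤ → Bool) (x : Fin n → ℤ) (u : Direction n) :
    twistedForm ε (x + u.vec) ≡
      oddForm x + oddForm (u.twist (ε (endDiff (x + u.vec)))).vec [ZMOD 2 * (2 * n)] := by
  rw [twistedForm, oddForm_add, add_assoc]
  exact (oddForm_vec_twist_modEq _ u).symm.add_left _

theorem eq_of_twistedForm_add_vec_modEq {ε : ℤ → Bool} {x : Fin n → ℤ} {u v : Direction n}
    (h : twistedForm ε (x + u.vec) ≡ twistedForm ε (x + v.vec) [ZMOD 2 * (2 * n)]) : u = v := by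
  have htwist : u.twist (ε (endDiff (x + u.vec))) = v.twist (ε (endDiff (x + v.vec))) :=
    eq_of_oddForm_vec_modEq <| Int.ModEq.add_left_cancel' _ <|
      (twistedForm_add_vec_modEq ε x u).symm.trans <| h.trans (twistedForm_add_vec_modEq ε x v)
  have hdiff : endDiff (x + u.vec) = endDiff (x + v.vec) := by
    rw [endDiff_add, endDiff_add, ← endDiff_vec_twist _ u, htwist, endDiff_vec_twist]
  rw [hdiff] at htwist
  exact Direction.twist_injective _ htwist

/-- The colouring of `ℤⁿ` by the residue of `twistedForm` modulo `4n`, where the residues `2k` and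
`2k + 1` give the same colour: all neighbours of a vertex have the same parity. -/
def twistedColor (ε : ℤ → Bool) (x : Fin n → ℤ) : Fin (2 * n) :=
  (ZMod.finEquiv (2 * n)).symm (twistedForm ε x / 2 : ℤ)

theorem twistedForm_modEq_of_twistedColor_eq {ε δ : ℤ → Bool} {x y : Fin n → ℤ}
    (hpar : oddForm x ≡ oddForm y [ZMOD 2]) (h : twistedColor ε x = twistedColor δ y) :
    twistedForm ε x ≡ twistedForm δ y [ZMOD 2 * (2 * n)] := by
  have hpar' : twistedForm ε x ≡ twistedForm δ y [ZMOD 2] :=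
    (twistedForm_modEq_two ε x).trans <| hpar.trans (twistedForm_modEq_two δ y).symm
  exact_mod_cast modEq_of_intCast_ediv_two_eq hpar' ((ZMod.finEquiv (2 * n)).symm.injective h)

theorem twistedColor_add_vec_bijective (ε : ℤ → Bool) (x : Fin n → ℤ) :
    Function.Bijective fun u : Direction n => twistedColor ε (x + u.vec) := by
  refine (Fintype.bijective_iff_injective_and_card _).2 ⟨fun u v h => ?_, by simp [mul_comm]⟩
  have hpar : oddForm (x + u.vec) ≡ oddForm (x + v.vec) [ZMOD 2] := by
    rw [oddForm_add, oddForm_add]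
    refine Int.ModEq.add_left _ ?_
    exact (Int.odd_iff.1 (odd_oddForm_vec u)).trans (Int.odd_iff.1 (odd_oddForm_vec v)).symm
  exact eq_of_twistedForm_add_vec_modEq (twistedForm_modEq_of_twistedColor_eq hpar h)

theorem twistedColor_injective (hn : 1 < n) :
    Function.Injective (twistedColor : (ℤ → Bool) → (Fin n → ℤ) → Fin (2 * n)) := by
  intro ε δ h
  funext k
  have hform := twistedForm_modEq_of_twistedColor_eq (Int.ModEq.refl _)
    (congrFun h (Pi.single 0 k))
  rw [twistedForm, twistedForm, endDiff_single_zero hn] at hform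
  have hshift : (if δ k then (2 * n : ℤ) else 0) - (if ε k then (2 * n : ℤ) else 0) = 0 := by
    refine Int.eq_zero_of_abs_lt_dvd hform.add_left_cancel'.dvd ?_
    rw [abs_lt]
    split_ifs <;> omega
  grind

end TwistedColoring

theorem BiasedPartition.mk_eq_two_power_aleph0 {n : ℕ} (hn : 1 < n) :
    #(BiasedPartition n) = 2 ^ ℵ₀ := by
  have : NeZero n := ⟨by omega⟩
  refine (mk_le_two_power_aleph0 n).antisymm ?_
  let twisted (ε : ℤ → Bool) : BiasedPartition n :=
    ofColoring (twistedColor ε) (twistedColor_add_vec_bijective ε)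
  have htwisted : Function.Injective twisted := fun ε δ h =>
    twistedColor_injective hn (ofColoring_inj h)
  calc 2 ^ ℵ₀ = #(ℤ → Bool) := by simp
    _ ≤ #(BiasedPartition n) := mk_le_of_injective htwisted

theorem theorem4p2 (n : ℕ) (hn : 1 < n) :
    Cardinal.mk (Quotient (BiasedPartition.isoSetoid n)) = 2 ^ Cardinal.aleph0 := by
  have hmk := BiasedPartition.mk_eq_two_power_aleph0 hn
  rw [← hmk]
  exact mk_quotient_eq_of_countable_classes _ BiasedPartition.countable_setOf_isomorphic
    (hmk ▸ cantor ℵ₀)
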